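/- Let $G=(V,E)$ be a finite quiver (a finite directed graph, multiple edges allowed) without self-loops; write $s(e)$ and $t(e)$ for the source and target of an edge $e$. For each vertex $v$ let $n_v\geq 1$ be an integer, and for each edge $e$ let $U_e$ be a complex matrix of size $n_{s(e)}\times n_{t(e)}$. Let $x_e\geq 0$ $(e\in E)$ and $\kappa_a\geq 0$ $(a\in V)$ be real numbers, and set $$z_a=\sum_{e:\,s(e)=a}x_e,\qquad p_e=\frac{x_e}{z_{s(e)}+\kappa_{s(e)}} .$$ Let $\Delta$ be the twisted Laplacian, the endomorphism of $\bigoplus_{v\in V}\mathbb{C}^{n_v}$ given by $$(\Delta f)(v)=\sum_{e:\,s(e)=v}x_e\big(f(s(e))-U_ef(t(e))\big),$$ and let $\mathrm{diag}(\kappa)$ act on the summand $\mathbb{C}^{n_a}$ as multiplication by $\kappa_a$. A cycle $c$ of $G$ is a sequence of edges $(e_1,\dots,e_k)$, $k\geq 1$, with $t(e_i)=s(e_{i+1})$ for $i<k$ and $t(e_k)=s(e_1)$, taken up to cyclic permutation (vertices and edges may be repeated). It is prime if its valuation, the order of the stabilizer of $(e_1,\dots,e_k)$ in $\mathbb{Z}/k\mathbb{Z}$,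 equals $1$. Let $\mathcal{P}(G)$ be the set of prime cycles. Put $\underline p^{\underline e(c)}=p_{e_1}\cdots p_{e_k}$ and $\mathrm{hol}(c)=U_{e_1}\cdots U_{e_k}$; the number $\det(I-\underline p^{\underline e(c)}\mathrm{hol}(c))$ does not depend on the choice of the starting edge. Assume that 1. from every vertex $a$ there is a (possibly empty) path, along edges $e$ with $x_e>0$, to a vertex $b$ with $\kappa_b>0$ (strict sub-Markovianity); 2. there are norms on the spaces $\mathbb{C}^{n_v}$ $(v\in V)$ such that for every edge $e$ the associated operator norm of $U_e:\mathbb{C}^{n_{t(e)}}\to\mathbb{C}^{n_{s(e)}}$ satisfies $\|U_e\|\leq 1$. Then the product below over the prime cycles of $G$ converges absolutely, that is $\sum_{c\in\mathcal{P}(G)}\big|\det\big(I-\underline p^{\underline e(c)}\mathrm{hol}(c)\big)-1\big|<\infty$, and $$\det\big(\mathrm{diag}(\kappa)+\Delta\big)=\Big(\prod_{a\in V}(z_a+\kappa_a)^{n_a}\Big)\prod_{c\in\mathcal{P}(G)}\det\big(I-\underline p^{\underline e(c)}\,\mathrm{hol}(c)\big).$$ -/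

import Mathlib

namespace QuiverEuler

universe u w

section Cycles

variable {V : Type u} [Quiver.{w} V]

/-- The list of edges traversed by a path, in the order in which they are traversed; an edge is
recorded together with its source and target. -/
def edges {a b : V} : Quiver.Path a b → List (Σ (s t : V), (s ⟶ t))
  | .nil => []
  | .cons (b := c) p e => edges p ++ [⟨c, b, e⟩]

theorem edges_comp {a b c : V} (p : Quiver.Path a b) (q : Quiver.Path b c) :
    edges (p.comp q) = edges p ++ edges q := by
  induction q with
  | nil => simp [edges]
  | cons q e ih => simp [edges, ih]

variable (V) in
/-- A closed path of positive length (a cycle with a choice of base point). -/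
structure ClosedWalk where
  base : V
  path : Quiver.Path base base
  pos : 0 < path.length

/-- Moving the base point: the closed path `p` followed by `q` is a rotation of `q` followed
by `p`. -/
inductive Rotates : ClosedWalk V → ClosedWalk V → Prop
  | mk {a b : V} (p : Quiver.Path a b) (q : Quiver.Path b a)
      (h : 0 < (p.comp q).length) (h' : 0 < (q.comp p).length) :
      Rotates ⟨a, p.comp q, h⟩ ⟨b, q.comp p, h'⟩

variable (V) in
/-- A cycle: a well-chained nonempty sequence of edges, up to cyclic permutation. It may visit
vertices and edges several times. -/
def QCycle : Type (max u w) := Quot (Rotates (V := V))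

/-- The order of the stabilizer in `ℤ/kℤ` of a list of length `k`, under cyclic permutations. -/
noncomputable def stabCard {α : Type*} (l : List α) : ℕ :=
  Set.ncard {i : ℕ | i < l.length ∧ l.rotate i = l}

theorem stabCard_rotate {α : Type*} (l : List α) (j : ℕ) :
    stabCard (l.rotate j) = stabCard l := by
  unfold stabCard
  congr 1
  ext i
  simp only [Set.mem_ofPred_eq, List.length_rotate, List.rotate_rotate]
  rw [Nat.add_comm j i, ← List.rotate_rotate, List.rotate_eq_rotate]

/-- The valuation of a cycle of length `k`: the order of the stabilizer in `ℤ/kℤ` of its sequence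
of edges. -/
noncomputable def valuation : QCycle V → ℕ :=
  Quot.lift (fun c => stabCard (edges c.path)) (by
    rintro _ _ ⟨p, q, h, h'⟩
    simp only [edges_comp]
    rw [← List.rotate_append_length_eq (edges p) (edges q), stabCard_rotate])

variable (V) in
/-- The prime cycles: those of valuation `1`. -/
def PrimeCycle : Type (max u w) := {c : QCycle V // valuation c = 1}

end Cycles

section Representation

variable {V : Type u} [Quiver.{w} V] {n : V → ℕ}

/-- The holonomy `U_{e₁} ⋯ U_{eₖ}` along the path with edges `e₁, …, eₖ`. -/
def hol (U : ∀ {a b : V}, (a ⟶ b) → Matrix (Fin (n a)) (Fin (n b)) ℂ) {a b : V} :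
    Quiver.Path a b → Matrix (Fin (n a)) (Fin (n b)) ℂ
  | .nil => 1
  | .cons p e => hol U p * U e

theorem hol_comp (U : ∀ {a b : V}, (a ⟶ b) → Matrix (Fin (n a)) (Fin (n b)) ℂ) {a b c : V}
    (p : Quiver.Path a b) (q : Quiver.Path b c) : hol U (p.comp q) = hol U p * hol U q := by
  induction q with
  | nil => simp [hol]
  | cons q e ih => simp [hol, ih, Matrix.mul_assoc]

/-- The factor `det (I - p(c) hol(c))` of a cycle `c`, where `p(c)` is the product of the weights
`p` of the edges of `c`; it does not depend on the base point. -/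
noncomputable def eulerFactor (U : ∀ {a b : V}, (a ⟶ b) → Matrix (Fin (n a)) (Fin (n b)) ℂ)
    (p : ∀ {a b : V}, (a ⟶ b) → ℝ) : QCycle V → ℂ :=
  Quot.lift (fun c => Matrix.det (1 - ((c.path.weight p : ℝ) : ℂ) • hol U c.path)) (by
    rintro _ _ ⟨r, s, h, h'⟩
    simp only [hol_comp, Quiver.Path.weight_comp]
    rw [← Matrix.smul_mul, Matrix.det_one_sub_mul_comm, Matrix.mul_smul, mul_comm])

variable [Fintype V] [∀ a b : V, Fintype (a ⟶ b)]

/-- `z_a`, the sum of the weights of the edges with source `a`. -/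
def outWeight (x : ∀ {a b : V}, (a ⟶ b) → ℝ) (a : V) : ℝ :=
  ∑ b : V, ∑ e : a ⟶ b, x e

/-- `p_e = x_e / (z_{s(e)} + κ_{s(e)})`. -/
noncomputable def transWeight (x : ∀ {a b : V}, (a ⟶ b) → ℝ) (κ : V → ℝ) {a b : V}
    (e : a ⟶ b) : ℝ :=
  x e / (outWeight x a + κ a)

/-- The twisted Laplacian, acting on `⨁_v ℂ^{n_v}` by
`(Δ f)(v) = ∑_{e : s(e) = v} x_e (f(s(e)) - U_e f(t(e)))`. -/
noncomputable def laplacian (x : ∀ {a b : V}, (a ⟶ b) → ℝ)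
    (U : ∀ {a b : V}, (a ⟶ b) → Matrix (Fin (n a)) (Fin (n b)) ℂ) :
    (∀ v : V, Fin (n v) → ℂ) →ₗ[ℂ] (∀ v : V, Fin (n v) → ℂ) where
  toFun f v := ∑ w : V, ∑ e : v ⟶ w, ((x e : ℝ) : ℂ) • (f v - (U e).mulVec (f w))
  map_add' f g := by
    funext v
    simp only [Pi.add_apply, Matrix.mulVec_add, ← Finset.sum_add_distrib]
    refine Finset.sum_congr rfl fun w _ => Finset.sum_congr rfl fun e _ => ?_
    rw [← smul_add]
    congr 1
    abel
  map_smul' c f := by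
    funext v
    simp only [Pi.smul_apply, Matrix.mulVec_smul, ← smul_sub, Finset.smul_sum, RingHom.id_apply]
    refine Finset.sum_congr rfl fun w _ => Finset.sum_congr rfl fun e _ => ?_
    rw [smul_comm]

end Representation

/-- The operator `diag(κ)`: multiplication by the scalar `κ_v` on the summand `ℂ^{n_v}`. -/
noncomputable def diagOp {V : Type u} (n : V → ℕ) (κ : V → ℝ) :
    (∀ v : V, Fin (n v) → ℂ) →ₗ[ℂ] (∀ v : V, Fin (n v) → ℂ) where
  toFun f v := ((κ v : ℝ) : ℂ) • f v
  map_add' f g := by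
    funext v
    simp
  map_smul' c f := by
    funext v
    simp only [Pi.smul_apply, RingHom.id_apply]
    rw [smul_comm]

end QuiverEuler

/-! Pulling the scalar `z_a + κ_a` out of the rows of block `a` factors `diag(κ) + Δ` as a diagonal
matrix times `1 - T`, where `T` is the block matrix with entries `∑ p_e U_e`
(`det_diagOp_add_laplacian`). It remains to expand `det (1 - T)` as an Euler product.

Since `T ^ k → 0`, `-log det (1 - T) = ∑ tr (T ^ k) / k` (`exists_hasSum_trace_pow`), and `tr (T ^
k)` is a sum over based closed walks of length `k` (`trace_blockMatrix_pow`). Every such walk is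
uniquely a power of a based prime walk (`bijective_pow_rotRep`). A prime cycle of length `ℓ` has
exactly `ℓ` base points; with `A` its weighted holonomy, each contributes `tr (A ^ k) / (k ℓ)` to
the `k`-th powers. Together they give `tr (A ^ k) / k`, and summing over `k` gives `-log det (1 -
A)`. Exponentiating turns the sum over prime cycles into the product. Logarithms enter only as some
`s` with `exp (-s)` equal to the determinant, so no branch has to be tracked.

Convergence has two sources: strict sub-Markovianity makes the row sums of the powers of the scalar
transition matrix summable (`summable_rowSum`), and the contraction hypothesis bounds the entries of
all holonomies by one constant (`exists_norm_hol_le`). The sum over closed walks is then absolutely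
convergent and may be regrouped freely. -/

namespace QuiverEuler

/-! ### Combinatorics on words: rotations, powers and primitive roots. -/

section RotationPeriod

variable {α : Type*}

/-- The least positive `d` such that rotating `l` by `d` gives back `l`. -/
noncomputable def rotPeriod (l : List α) : ℕ :=
  Function.minimalPeriod (fun m : List α => m.rotate 1) l

theorem rotate_one_iterate (l : List α) (i : ℕ) :
    (fun m : List α => m.rotate 1)^[i] l = l.rotate i := by
  induction i with
  | zero => simp
  | succ i ih => rw [Function.iterate_succ_apply', ih, List.rotate_rotate]

theorem isPeriodicPt_rotate_iff (l : List α) (i : ℕ) :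
    Function.IsPeriodicPt (fun m : List α => m.rotate 1) i l ↔ l.rotate i = l := by
  rw [Function.IsPeriodicPt, Function.IsFixedPt, rotate_one_iterate]

theorem rotPeriod_dvd_iff (l : List α) (i : ℕ) : rotPeriod l ∣ i ↔ l.rotate i = l := by
  rw [← isPeriodicPt_rotate_iff, Function.isPeriodicPt_iff_minimalPeriod_dvd, rotPeriod]

theorem rotPeriod_dvd_length (l : List α) : rotPeriod l ∣ l.length := by
  rw [rotPeriod_dvd_iff, List.rotate_length]

theorem rotPeriod_pos {l : List α} (hl : 0 < l.length) : 0 < rotPeriod l :=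
  Nat.pos_of_dvd_of_pos (rotPeriod_dvd_length l) hl

theorem stabCard_eq_one_iff {l : List α} (hl : 0 < l.length) :
    stabCard l = 1 ↔ rotPeriod l = l.length := by
  unfold stabCard
  rw [Set.ncard_eq_one]
  constructor
  · rintro ⟨a, ha⟩
    have h0 : (0 : ℕ) ∈ {i : ℕ | i < l.length ∧ l.rotate i = l} := ⟨hl, List.rotate_zero l⟩
    refine (Nat.le_of_dvd hl (rotPeriod_dvd_length l)).eq_of_not_lt fun hlt => ?_
    have h1 : rotPeriod l ∈ {i : ℕ | i < l.length ∧ l.rotate i = l} :=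
      ⟨hlt, (rotPeriod_dvd_iff l _).1 dvd_rfl⟩
    rw [ha] at h0 h1
    have := rotPeriod_pos hl
    simp only [Set.mem_singleton_iff] at h0 h1
    omega
  · intro h
    refine ⟨0, Set.ext fun i => ⟨?_, ?_⟩⟩
    · rintro ⟨hi, hr⟩
      rw [← rotPeriod_dvd_iff, h] at hr
      exact Nat.eq_zero_of_dvd_of_lt hr hi
    · rintro rfl
      exact ⟨hl, List.rotate_zero l⟩

/-- The concatenation of `k` copies of a list. -/
def listPow (m : List α) (k : ℕ) : List α := (List.replicate k m).flatten

theorem listPow_succ (m : List α) (k : ℕ) : listPow m (k + 1) = m ++ listPow m k := by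
  simp [listPow, List.replicate_succ]

@[simp] theorem listPow_zero (m : List α) : listPow m 0 = [] := rfl

theorem length_listPow (m : List α) (k : ℕ) : (listPow m k).length = k * m.length := by
  simp [listPow]

theorem listPow_append_comm (a b : List α) (k : ℕ) :
    listPow (a ++ b) k ++ a = a ++ listPow (b ++ a) k := by
  induction k with
  | zero => simp
  | succ k ih => simp only [listPow_succ, List.append_assoc, ih]

theorem listPow_rotate_one (m : List α) (k : ℕ) :
    (listPow m k).rotate 1 = listPow (m.rotate 1) k := by
  cases m with
  | nil => simp [listPow]
  | cons x t =>
    cases k with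
    | zero => simp
    | succ k =>
      have h := listPow_append_comm [x] t k
      simp only [List.cons_append, List.nil_append] at h
      simp only [listPow_succ, List.cons_append, List.rotate_cons_succ, List.rotate_zero,
        List.append_assoc, h, List.nil_append]

theorem listPow_rotate (m : List α) (k i : ℕ) :
    (listPow m k).rotate i = listPow (m.rotate i) k := by
  induction i with
  | zero => simp
  | succ i ih => rw [← List.rotate_rotate, ih, listPow_rotate_one, List.rotate_rotate]

theorem listPow_succ_injective (k : ℕ) :
    Function.Injective fun m : List α => listPow m (k + 1) := by
  intro m m' h
  have hl := congrArg List.length h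
  simp only [length_listPow] at hl
  simp only [listPow_succ] at h
  exact (List.append_inj h (Nat.eq_of_mul_eq_mul_left k.succ_pos hl)).1

/-- Rotation commutes with taking powers and nonzero powers are injective, so a rotation fixes `m`
exactly when it fixes its power. -/
theorem rotPeriod_listPow (m : List α) (k : ℕ) :
    rotPeriod (listPow m (k + 1)) = rotPeriod m := by
  refine Nat.dvd_antisymm ?_ ?_
  · rw [rotPeriod_dvd_iff, listPow_rotate, (rotPeriod_dvd_iff m _).1 dvd_rfl]
  · rw [rotPeriod_dvd_iff]
    apply listPow_succ_injective k
    simp only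
    rw [← listPow_rotate, (rotPeriod_dvd_iff _ _).1 dvd_rfl]

/-- Both `a` and `b` are prefixes of the same word, so `a` is a prefix of `b`; cancelling it leaves
a shorter word that still commutes with `a`. -/
theorem eq_listPow_of_append_comm {a : List α} (q : ℕ) {b : List α} (hb : b.length = q * a.length)
    (h : a ++ b = b ++ a) : b = listPow a q := by
  induction q generalizing b with
  | zero => simpa using hb
  | succ q ih =>
    obtain ⟨b', rfl⟩ : a <+: b :=
      List.prefix_of_prefix_length_le (List.prefix_append a b) (h ▸ List.prefix_append b a)
        (by rw [hb]; exact Nat.le_mul_of_pos_left _ q.succ_pos)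
    rw [List.append_assoc, List.append_cancel_left_eq] at h
    rw [listPow_succ, ← ih _ h]
    rw [List.length_append, Nat.succ_mul] at hb
    omega

/-- Every nonempty list is a power of a list which equals none of its proper rotations. -/
theorem exists_eq_listPow {l : List α} (hl : 0 < l.length) :
    ∃ (m : List α) (k : ℕ), 0 < m.length ∧ rotPeriod m = m.length ∧ l = listPow m (k + 1) := by
  obtain ⟨q, hq⟩ := rotPeriod_dvd_length l
  have hd := rotPeriod_pos hl
  obtain ⟨k, rfl⟩ : ∃ k, q = k + 1 := Nat.exists_eq_succ_of_ne_zero (by rintro rfl; omega)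
  have hle : rotPeriod l ≤ l.length := Nat.le_of_dvd hl (rotPeriod_dvd_length l)
  have hlen : (l.take (rotPeriod l)).length = rotPeriod l := by simp [hle]
  have hrot : l.drop (rotPeriod l) ++ l.take (rotPeriod l) = l := by
    rw [← List.rotate_eq_drop_append_take hle]
    exact (rotPeriod_dvd_iff l _).1 dvd_rfl
  have hpow : l.drop (rotPeriod l) = listPow (l.take (rotPeriod l)) k := by
    refine eq_listPow_of_append_comm k ?_ ?_
    · rw [hlen, List.length_drop, hq, Nat.mul_succ, Nat.mul_comm k,
        Nat.add_sub_cancel]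
    · rw [List.take_append_drop, hrot]
  have h : l = listPow (l.take (rotPeriod l)) (k + 1) := by
    rw [listPow_succ, ← hpow, List.take_append_drop]
  refine ⟨_, k, by rwa [hlen], ?_, h⟩
  rw [hlen]
  conv_rhs => rw [h]
  rw [rotPeriod_listPow]

/-- The rotation period of the common power recovers the length of the root, hence the exponent, and
then the root itself. -/
theorem listPow_inj {m m' : List α} {k k' : ℕ} (hpos : 0 < m.length)
    (hm : rotPeriod m = m.length) (hm' : rotPeriod m' = m'.length)
    (h : listPow m (k + 1) = listPow m' (k' + 1)) : m = m' ∧ k = k' := by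
  have hlen : m.length = m'.length := by
    rw [← hm, ← hm', ← rotPeriod_listPow m k, h, rotPeriod_listPow]
  have hl := congrArg List.length h
  rw [length_listPow, length_listPow, ← hlen] at hl
  obtain rfl : k = k' := by simpa using Nat.eq_of_mul_eq_mul_right hpos hl
  exact ⟨listPow_succ_injective k h, rfl⟩

end RotationPeriod

/-! ### Closed walks as powers of prime cycles. -/

section ClosedWalks

variable {V : Type*} [Quiver V]

@[simp] theorem edges_nil (a : V) : edges (Quiver.Path.nil : Quiver.Path a a) = [] := rfl

@[simp] theorem edges_cons {a b c : V} (p : Quiver.Path a b) (e : b ⟶ c) :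
    edges (p.cons e) = edges p ++ [⟨b, c, e⟩] := rfl

@[simp] theorem length_edges {a b : V} (p : Quiver.Path a b) : (edges p).length = p.length := by
  induction p with
  | nil => rfl
  | cons p e ih => simp [ih]

theorem eq_of_edges_eq {a b b' : V} (p : Quiver.Path a b) (q : Quiver.Path a b')
    (h : edges p = edges q) : ∃ hb : b = b', p.cast rfl hb = q := by
  induction p generalizing b' with
  | nil =>
    cases q with
    | nil => exact ⟨rfl, rfl⟩
    | cons q f => simp at h
  | cons p e ih =>
    cases q with
    | nil => simp at h
    | cons q f =>
      simp only [edges_cons, List.append_singleton_inj] at h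
      obtain ⟨rfl, rfl⟩ := ih q h.1
      have h2 := h.2
      simp only [Sigma.mk.injEq, true_and, heq_eq_eq] at h2
      obtain ⟨rfl, h3⟩ := h2
      simp only [heq_eq_eq] at h3
      subst h3
      exact ⟨rfl, rfl⟩

theorem head?_edges {a b : V} (p : Quiver.Path a b) : ∀ s ∈ (edges p).head?, s.1 = a := by
  induction p with
  | nil => simp
  | cons p e ih =>
    cases p with
    | nil => simp
    | cons p f => simpa [List.head?_append] using ih

/-- Transfers splittings of edge lists back to paths, so that rotations and roots found for lists
come from closed walks. -/
theorem exists_comp_of_edges_eq_append {a b : V} (p : Quiver.Path a b)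
    {l m : List (Σ (s t : V), (s ⟶ t))} (h : edges p = l ++ m) :
    ∃ (c : V) (q : Quiver.Path a c) (r : Quiver.Path c b),
      p = q.comp r ∧ edges q = l ∧ edges r = m := by
  induction p generalizing m with
  | nil =>
    obtain ⟨rfl, rfl⟩ := List.append_eq_nil_iff.1 h.symm
    exact ⟨a, .nil, .nil, rfl, rfl, rfl⟩
  | cons p e ih =>
    rcases List.eq_nil_or_concat m with rfl | ⟨m', s, rfl⟩
    · exact ⟨_, p.cons e, .nil, rfl, by simpa using h, rfl⟩
    · simp only [edges_cons, List.concat_eq_append, ← List.append_assoc,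
        List.append_singleton_inj] at h
      obtain ⟨c, q, r, rfl, h1, h2⟩ := ih h.1
      exact ⟨c, q, r.cons e, rfl, h1, by simp [h2, h.2]⟩

namespace ClosedWalk

/-- The sequence of edges of a closed walk. -/
def edgeList (w : ClosedWalk V) : List (Σ (s t : V), (s ⟶ t)) := edges w.path

theorem length_edgeList (w : ClosedWalk V) : w.edgeList.length = w.path.length :=
  length_edges _

theorem edgeList_pos (w : ClosedWalk V) : 0 < w.edgeList.length := by
  rw [length_edgeList]
  exact w.pos

theorem edgeList_injective : Function.Injective (edgeList (V := V)) := by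
  rintro ⟨a, p, hp⟩ ⟨b, q, hq⟩ h
  simp only [edgeList] at h
  have hab : a = b := by
    rw [← length_edges] at hp
    have h1 := head?_edges p _ (List.head?_eq_some_head (List.ne_nil_of_length_pos hp))
    have h2 := head?_edges q _ (by
      rw [← h]
      exact List.head?_eq_some_head (List.ne_nil_of_length_pos hp))
    exact h1.symm.trans h2
  subst hab
  obtain ⟨_, rfl⟩ := eq_of_edges_eq p q h
  rfl

theorem exists_rotate (w : ClosedWalk V) (i : ℕ) :
    ∃ w' : ClosedWalk V, w'.edgeList = w.edgeList.rotate i ∧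
      (Quot.mk _ w' : QCycle V) = Quot.mk _ w := by
  obtain ⟨a, p, hp⟩ := w
  have hle : i % (edges p).length ≤ (edges p).length :=
    (Nat.mod_lt _ (by rwa [length_edges])).le
  obtain ⟨c, q, r, rfl, hq, hr⟩ := exists_comp_of_edges_eq_append p
    (List.take_append_drop (i % (edges p).length) (edges p)).symm
  have hp' : 0 < (r.comp q).length := by
    rw [Quiver.Path.length_comp] at hp ⊢
    omega
  refine ⟨⟨c, r.comp q, hp'⟩, ?_, (Quot.sound (Rotates.mk q r hp hp')).symm⟩
  simp only [edgeList]
  rw [← List.rotate_mod, List.rotate_eq_drop_append_take hle, ← hq, ← hr, edges_comp]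

theorem isRotated_of_mk_eq {w w' : ClosedWalk V} (h : (Quot.mk _ w : QCycle V) = Quot.mk _ w') :
    w.edgeList ~r w'.edgeList := by
  -- The class in `Cycle` is invariant under `Rotates`, so it descends to `QCycle` without unfolding
  -- the generated equivalence relation.
  have key : ∀ v v' : ClosedWalk V, Rotates v v' →
      (v.edgeList : Cycle (Σ (s t : V), (s ⟶ t))) = (v'.edgeList : Cycle _) := by
    rintro _ _ ⟨p, q, _, _⟩
    rw [Cycle.coe_eq_coe]
    simp only [edgeList, edges_comp]
    exact List.isRotated_append
  exact Cycle.coe_eq_coe.1 (congrArg (Quot.lift _ key) h)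

/-- The closed path `p` followed `k` times. -/
def powPath {a : V} (p : Quiver.Path a a) : ℕ → Quiver.Path a a
  | 0 => .nil
  | k + 1 => p.comp (powPath p k)

theorem edges_powPath {a : V} (p : Quiver.Path a a) (k : ℕ) :
    edges (powPath p k) = listPow (edges p) k := by
  induction k with
  | zero => rfl
  | succ k ih => rw [powPath, edges_comp, ih, listPow_succ]

/-- The closed walk `w` followed `k + 1` times. -/
def pow (w : ClosedWalk V) (k : ℕ) : ClosedWalk V where
  base := w.base
  path := powPath w.path (k + 1)
  pos := by
    rw [powPath, Quiver.Path.length_comp]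
    have := w.pos
    omega

theorem edgeList_pow (w : ClosedWalk V) (k : ℕ) :
    (w.pow k).edgeList = listPow w.edgeList (k + 1) :=
  edges_powPath _ _

theorem exists_eq_pow (w : ClosedWalk V) {m : List (Σ (s t : V), (s ⟶ t))} (hm : 0 < m.length)
    {k : ℕ} (h : w.edgeList = listPow m (k + 1)) :
    ∃ v : ClosedWalk V, v.edgeList = m ∧ w = v.pow k := by
  suffices hv : ∃ v : ClosedWalk V, v.edgeList = m by
    obtain ⟨v, hv⟩ := hv
    exact ⟨v, hv, edgeList_injective (by rw [edgeList_pow, hv, h])⟩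
  rw [listPow_succ] at h
  obtain ⟨c, q, r, hw, hq, hr⟩ := exists_comp_of_edges_eq_append w.path h
  -- The first copy of `m` closes up: either nothing follows it, or the next copy starts with the
  -- same edge, whose source is both `c` and the base.
  have hc : c = w.base := by
    cases k with
    | zero =>
      have h0 : r.length = 0 := by rw [← length_edges, hr]; rfl
      exact Quiver.Path.eq_of_length_zero r h0
    | succ k =>
      rw [listPow_succ] at hr
      have hh := List.head?_eq_some_head (List.ne_nil_of_length_pos hm)
      have h1 := head?_edges q _ (by rw [hq]; exact hh)
      have h2 := head?_edges r _ (by rw [hr, List.head?_append, hh]; rfl)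
      exact h2.symm.trans h1
  subst hc
  exact ⟨⟨_, q, by rwa [← length_edges, hq]⟩, hq⟩

end ClosedWalk

theorem valuation_mk_eq_one_iff (w : ClosedWalk V) :
    valuation (Quot.mk _ w) = 1 ↔ rotPeriod w.edgeList = w.edgeList.length :=
  stabCard_eq_one_iff w.edgeList_pos

namespace PrimeCycle

/-- A closed walk representing a prime cycle. -/
noncomputable def rep (c : PrimeCycle V) : ClosedWalk V := Quot.out c.1

theorem mk_rep (c : PrimeCycle V) : (Quot.mk _ c.rep : QCycle V) = c.1 := Quot.out_eq c.1

theorem rotPeriod_rep (c : PrimeCycle V) :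
    rotPeriod c.rep.edgeList = c.rep.edgeList.length := by
  rw [← valuation_mk_eq_one_iff, mk_rep]
  exact c.2

/-- The representative of a prime cycle based after `i` steps. -/
noncomputable def rotRep (c : PrimeCycle V) (i : ℕ) : ClosedWalk V :=
  (c.rep.exists_rotate i).choose

theorem edgeList_rotRep (c : PrimeCycle V) (i : ℕ) :
    (c.rotRep i).edgeList = c.rep.edgeList.rotate i :=
  (c.rep.exists_rotate i).choose_spec.1

theorem mk_rotRep (c : PrimeCycle V) (i : ℕ) : (Quot.mk _ (c.rotRep i) : QCycle V) = c.1 :=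
  (c.rep.exists_rotate i).choose_spec.2.trans c.mk_rep

theorem length_rotRep (c : PrimeCycle V) (i : ℕ) :
    (c.rotRep i).path.length = c.rep.path.length := by
  rw [← ClosedWalk.length_edgeList, edgeList_rotRep, List.length_rotate,
    ClosedWalk.length_edgeList]

theorem rotPeriod_rotRep (c : PrimeCycle V) (i : ℕ) :
    rotPeriod (c.rotRep i).edgeList = (c.rotRep i).edgeList.length := by
  rw [← valuation_mk_eq_one_iff, mk_rotRep]
  exact c.2

end PrimeCycle

variable (V) in
/-- Every closed walk is, in a unique way, a power of a closed walk representing a prime cycle. -/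
theorem bijective_pow_rotRep : Function.Bijective
    fun s : Σ c : PrimeCycle V, ℕ × Fin c.rep.path.length => (s.1.rotRep s.2.2).pow s.2.1 := by
  constructor
  · rintro ⟨c, k, i⟩ ⟨c', k', i'⟩ h
    have h' := congrArg ClosedWalk.edgeList h
    simp only [ClosedWalk.edgeList_pow] at h'
    obtain ⟨h1, rfl⟩ := listPow_inj (ClosedWalk.edgeList_pos _) (c.rotPeriod_rotRep i)
      (c'.rotPeriod_rotRep i') h'
    obtain rfl : c = c' := by
      apply Subtype.ext
      rw [← c.mk_rotRep i, ← c'.mk_rotRep i', ClosedWalk.edgeList_injective h1]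
    rw [c.edgeList_rotRep, c.edgeList_rotRep, ← rotate_one_iterate, ← rotate_one_iterate] at h1
    have hp : Function.minimalPeriod (fun m : List (Σ (s t : V), (s ⟶ t)) => m.rotate 1)
        c.rep.edgeList = c.rep.path.length :=
      c.rotPeriod_rep.trans c.rep.length_edgeList
    -- Primality says that the minimal period is the full length, so the rotations by `i < ℓ` are
    -- pairwise distinct.
    have hi : (i : ℕ) = i' :=
      Function.iterate_injOn_Iio_minimalPeriod (by rw [hp]; exact i.2) (by rw [hp]; exact i'.2) h1
    rw [Fin.ext hi]
  · intro w
    obtain ⟨m, k, hpos, hm, hw⟩ := exists_eq_listPow w.edgeList_pos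
    obtain ⟨v, rfl, rfl⟩ := w.exists_eq_pow hpos hw
    let c : PrimeCycle V := ⟨Quot.mk _ v, (valuation_mk_eq_one_iff v).2 hm⟩
    obtain ⟨i, hi⟩ := ClosedWalk.isRotated_of_mk_eq c.mk_rep
    refine ⟨⟨c, k, ⟨i % c.rep.path.length, Nat.mod_lt _ c.rep.pos⟩⟩, ?_⟩
    have : c.rotRep (i % c.rep.path.length) = v := by
      apply ClosedWalk.edgeList_injective
      rw [c.edgeList_rotRep, ← ClosedWalk.length_edgeList, List.rotate_mod, hi]
    simp only [this]

end ClosedWalks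

/-! ### Traces of powers and the logarithm of a determinant. -/

section TraceDet

open Module LinearMap

theorem det_blockDiagonal' {R o : Type*} {n : o → Type*} [CommRing R] [Fintype o] [DecidableEq o]
    [∀ i, Fintype (n i)] [∀ i, DecidableEq (n i)] (A : ∀ i, Matrix (n i) (n i) R) :
    (Matrix.blockDiagonal' A).det = ∏ i, (A i).det := by
  let _ : LinearOrder o := IsWellOrder.linearOrder WellOrderingRel
  have h := (Matrix.blockTriangular_blockDiagonal' A).det_fintype
  convert h using 2 with i
  · let e : n i ≃ { x : Σ i, n i // x.1 = i } :=
      { toFun := fun j => ⟨⟨i, j⟩, rfl⟩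
        invFun := fun x => x.2 ▸ x.1.2
        left_inv := fun j => rfl
        right_inv := by rintro ⟨⟨i, j⟩, rfl⟩; rfl }
    rw [← Matrix.det_submatrix_equiv_self e]
    congr 1
    ext a b
    simp [Matrix.toSquareBlock, Matrix.toSquareBlockProp, e]

theorem det_eq_prod_det_restrict {R M ι : Type*} [CommRing R] [AddCommGroup M] [Module R M]
    [DecidableEq ι] {N : ι → Submodule R M} [∀ i, Module.Finite R (N i)]
    [∀ i, Module.Free R (N i)] (h : DirectSum.IsInternal N) [Fintype ι]
    {f : M →ₗ[R] M} (hf : ∀ i, Set.MapsTo f (N i) (N i)) :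
    LinearMap.det f = ∏ i, LinearMap.det (f.restrict (hf i)) := by
  classical
  let b : (i : ι) → Basis _ R (N i) := fun i ↦ Module.Free.chooseBasis R (N i)
  rw [← det_toMatrix (h.collectedBasis b),
    toMatrix_directSum_collectedBasis_eq_blockDiagonal' h h b b hf,
    det_blockDiagonal']
  simp_rw [det_toMatrix]

variable {M : Type*} [AddCommGroup M] [Module ℂ M] [FiniteDimensional ℂ M]

/-- `f ^ k - μ ^ k` is a multiple of the nilpotent `f - μ` by a commuting factor, hence nilpotent
and of trace zero. -/
theorem trace_pow_of_isNilpotent_sub {f : End ℂ M} {μ : ℂ}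
    (h : IsNilpotent (f - algebraMap ℂ (End ℂ M) μ)) (k : ℕ) :
    trace ℂ M (f ^ k) = finrank ℂ M * μ ^ k := by
  have hc : Commute f (algebraMap ℂ (End ℂ M) μ) := (Algebra.commutes μ f).symm
  have h1 : IsNilpotent (f ^ k - algebraMap ℂ (End ℂ M) μ ^ k) := by
    rw [← hc.mul_geom_sum₂]
    refine Commute.isNilpotent_mul_right ?_ h
    refine Commute.sum_right _ _ _ fun i _ => ?_
    exact ((Commute.refl f).sub_left hc.symm).pow_right _ |>.mul_right
      ((hc.sub_left (Commute.refl _)).pow_right _)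
  have h2 := (isNilpotent_trace_of_isNilpotent h1).eq_zero
  rw [map_sub, sub_eq_zero, ← map_pow] at h2
  rw [h2, Algebra.algebraMap_eq_smul_one, map_smul, trace_one, smul_eq_mul, mul_comm]

/-- Evaluate at `1 - μ` the characteristic polynomial of `f - μ`, which is a power of `X`. -/
theorem det_one_sub_of_isNilpotent_sub {f : End ℂ M} {μ : ℂ}
    (h : IsNilpotent (f - algebraMap ℂ (End ℂ M) μ)) :
    LinearMap.det (1 - f) = (1 - μ) ^ finrank ℂ M := by
  have h1 := eval_charpoly (f - algebraMap ℂ (End ℂ M) μ) (1 - μ)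
  rw [h.charpoly_eq_X_pow_finrank] at h1
  simp only [Polynomial.eval_pow, Polynomial.eval_X] at h1
  rw [h1]
  congr 1
  simp

/-- Decompose into generalized eigenspaces; `d μ` is the dimension of the one at `μ`, and the same
data compute the determinant and all the traces. -/
theorem exists_eigenvalue_multiplicities (f : End ℂ M) :
    ∃ (s : Finset ℂ) (d : ℂ → ℕ), (∀ μ ∈ s, f.HasEigenvalue μ) ∧
      LinearMap.det (1 - f) = ∏ μ ∈ s, (1 - μ) ^ d μ ∧
      ∀ k : ℕ, trace ℂ M (f ^ k) = ∑ μ ∈ s, (d μ : ℂ) * μ ^ k := by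
  classical
  have hint : DirectSum.IsInternal f.maxGenEigenspace :=
    DirectSum.isInternal_submodule_of_iSupIndep_of_iSup_eq_top
      f.independent_maxGenEigenspace f.iSup_maxGenEigenspace_eq_top
  have hfin : {μ | f.maxGenEigenspace μ ≠ ⊥}.Finite :=
    WellFoundedGT.finite_ne_bot_of_iSupIndep f.independent_maxGenEigenspace
  let _ : Fintype {μ // f.maxGenEigenspace μ ≠ ⊥} := hfin.fintype
  let _ : Fintype {μ | f.maxGenEigenspace μ ≠ ⊥} := hfin.fintype
  have hint' := DirectSum.isInternal_ne_bot_iff.mpr hint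
  have hmaps : ∀ (g : End ℂ M), Commute f g → ∀ μ,
      Set.MapsTo g (f.maxGenEigenspace μ) (f.maxGenEigenspace μ) :=
    fun g hg μ => f.mapsTo_maxGenEigenspace_of_comm hg μ
  have hnil := fun μ => f.isNilpotent_restrict_maxGenEigenspace_sub_algebraMap μ
  have hnil' : ∀ μ, IsNilpotent (f.restrict (hmaps f (Commute.refl f) μ) - algebraMap ℂ _ μ) :=
    hnil
  refine ⟨hfin.toFinset, fun μ => finrank ℂ (f.maxGenEigenspace μ), ?_, ?_, ?_⟩
  · intro μ hμ
    have : f.HasUnifEigenvalue μ ⊤ := hfin.mem_toFinset.1 hμ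
    exact this.lt (by simp)
  · have hc : Commute f (1 - f) := (Commute.one_right f).sub_right (Commute.refl f)
    rw [det_eq_prod_det_restrict hint' fun μ => hmaps _ hc μ,
      ← Finset.prod_coe_sort hfin.toFinset]
    refine Fintype.prod_equiv hfin.subtypeEquivToFinset _ _ fun μ => ?_
    exact det_one_sub_of_isNilpotent_sub (hnil' μ)
  · intro k
    have hc : Commute f (f ^ k) := Commute.self_pow f k
    rw [trace_eq_sum_trace_restrict hint' fun μ => hmaps _ hc μ, ← Finset.sum_coe_sort hfin.toFinset]
    refine Fintype.sum_equiv hfin.subtypeEquivToFinset _ _ fun μ => ?_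
    rw [← Module.End.pow_restrict k (hmaps f (Commute.refl f) μ)]
    exact trace_pow_of_isNilpotent_sub (hnil' μ) k

/-- If `A ^ k → 0` then `log det (1 - A) = - ∑ tr (A ^ k) / k`. -/
theorem exists_hasSum_trace_pow {ι : Type*} [Fintype ι] [DecidableEq ι] (A : Matrix ι ι ℂ)
    (hA : ∀ i j, Filter.Tendsto (fun k => (A ^ k) i j) Filter.atTop (nhds 0)) :
    ∃ s : ℂ, HasSum (fun k : ℕ => (A ^ (k + 1)).trace / (k + 1)) s ∧
      Complex.exp (-s) = (1 - A).det := by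
  obtain ⟨S, d, hS, hdet, htr⟩ := exists_eigenvalue_multiplicities (Matrix.toLin' A)
  have hnorm : ∀ μ ∈ S, ‖μ‖ < 1 := by
    intro μ hμ
    obtain ⟨v, hv⟩ := (hS μ hμ).exists_hasEigenvector
    obtain ⟨i, hi⟩ : ∃ i, v i ≠ 0 := Function.ne_iff.1 hv.2
    have h1 : ∀ k, (A ^ k).mulVec v i = μ ^ k * v i := fun k => by
      have := congrFun (hv.pow_apply k) i
      rwa [← Matrix.toLin'_pow, Matrix.toLin'_apply] at this
    have h2 : Filter.Tendsto (fun k => μ ^ k * v i) Filter.atTop (nhds 0) := by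
      simp_rw [← h1, Matrix.mulVec, dotProduct]
      have := tendsto_finsetSum Finset.univ fun j _ => (hA i j).mul_const (v j)
      simpa using this
    have h3 : Filter.Tendsto (fun k => μ ^ k) Filter.atTop (nhds 0) := by
      simpa [hi] using h2.mul_const (v i)⁻¹
    exact tendsto_pow_atTop_nhds_zero_iff_norm_lt_one.1 h3
  refine ⟨∑ μ ∈ S, (d μ : ℂ) * -Complex.log (1 - μ), ?_, ?_⟩
  · have h1 : HasSum (fun k : ℕ => ∑ μ ∈ S, (d μ : ℂ) * (μ ^ (k + 1) / ((k + 1 : ℕ) : ℂ)))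
        (∑ μ ∈ S, (d μ : ℂ) * -Complex.log (1 - μ)) := by
      refine hasSum_sum fun μ hμ => HasSum.mul_left _ ?_
      -- The dropped term of index `0` is `μ ^ 0 / 0 = 0`.
      simpa using
        (hasSum_nat_add_iff' 1).2 (Complex.hasSum_taylorSeries_neg_log (hnorm μ hμ))
    convert h1 using 2 with k
    · rw [← Matrix.trace_toLin'_eq, Matrix.toLin'_pow, htr, Finset.sum_div]
      push_cast
      simp_rw [mul_div_assoc]
  · rw [← Finset.sum_neg_distrib, Complex.exp_sum]
    have h1 : (1 - A).det = LinearMap.det (1 - Matrix.toLin' A) := by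
      rw [← LinearMap.det_toLin', map_sub, Matrix.toLin'_one]
      rfl
    rw [h1, hdet]
    refine Finset.prod_congr rfl fun μ hμ => ?_
    have hne : 1 - μ ≠ 0 := by
      intro h
      have := hnorm μ hμ
      rw [← sub_eq_zero.1 h] at this
      simp at this
    rw [mul_neg, neg_neg, Complex.exp_nat_mul, Complex.exp_log hne]

end TraceDet

/-! ### Powers of transition matrices as sums over paths. -/

section PathSums

variable {V : Type*} [Quiver V]

/-- The paths of a given length between two vertices. -/
abbrev PathOfLength (a b : V) (k : ℕ) := {p : Quiver.Path a b // p.length = k}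

/-- Removing the last edge of a path. -/
def pathSuccEquiv (a b : V) (k : ℕ) :
    PathOfLength a b (k + 1) ≃ Σ c : V, PathOfLength a c k × (c ⟶ b) where
  toFun
    | ⟨.cons p e, h⟩ => ⟨_, ⟨p, Nat.succ.inj h⟩, e⟩
  invFun s := ⟨s.2.1.1.cons s.2.2, congrArg Nat.succ s.2.1.2⟩
  left_inv := by
    rintro ⟨_ | ⟨p, e⟩, h⟩
    · simp at h
    · rfl
  right_inv := by
    rintro ⟨c, ⟨p, h⟩, e⟩
    rfl

theorem isEmpty_pathOfLength_zero {a b : V} (h : a ≠ b) : IsEmpty (PathOfLength a b 0) :=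
  ⟨fun p => h (Quiver.Path.eq_of_length_zero p.1 p.2)⟩

variable [Fintype V] [∀ a b : V, Fintype (a ⟶ b)]

instance finite_pathOfLength (a b : V) (k : ℕ) : Finite (PathOfLength a b k) := by
  induction k generalizing b with
  | zero =>
    refine Finite.of_injective (β := Unit) (fun _ => ()) ?_
    rintro ⟨p, hp⟩ ⟨q, hq⟩ _
    cases p with
    | nil => cases q with
      | nil => rfl
      | cons q f => simp at hq
    | cons p e => simp at hp
  | succ k ih => exact Finite.of_equiv _ (pathSuccEquiv a b k).symm

noncomputable instance fintypePathOfLength (a b : V) (k : ℕ) : Fintype (PathOfLength a b k) :=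
  Fintype.ofFinite _

theorem sum_pathOfLength_succ {R : Type*} [AddCommMonoid R] (a b : V) (k : ℕ)
    (F : Quiver.Path a b → R) :
    ∑ p : PathOfLength a b (k + 1), F p.1 =
      ∑ c : V, ∑ p : PathOfLength a c k, ∑ e : c ⟶ b, F (p.1.cons e) := by
  rw [← Equiv.sum_comp (pathSuccEquiv a b k).symm, Fintype.sum_sigma]
  refine Finset.sum_congr rfl fun c _ => ?_
  rw [Fintype.sum_prod_type]
  rfl

theorem sum_pathOfLength_zero_self {R : Type*} [AddCommMonoid R] (a : V)
    (F : Quiver.Path a a → R) : ∑ p : PathOfLength a a 0, F p.1 = F .nil := by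
  have : ∀ p : PathOfLength a a 0, p = ⟨.nil, rfl⟩ := by
    rintro ⟨p, hp⟩
    cases p with
    | nil => rfl
    | cons p e => simp at hp
  rw [Fintype.sum_eq_single ⟨.nil, rfl⟩ fun p hp => (hp (this p)).elim]

/-- The matrix whose `(a, b)` entry is the sum of the weights of the edges from `a` to `b`. -/
def edgeMatrix (p : ∀ {a b : V}, (a ⟶ b) → ℝ) : Matrix V V ℝ :=
  fun a b => ∑ e : a ⟶ b, p e

theorem edgeMatrix_pow_apply [DecidableEq V] (p : ∀ {a b : V}, (a ⟶ b) → ℝ) (k : ℕ) (a b : V) :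
    (edgeMatrix p ^ k) a b = ∑ r : PathOfLength a b k, r.1.weight p := by
  induction k generalizing b with
  | zero =>
    rw [pow_zero]
    by_cases hab : a = b
    · subst hab
      rw [sum_pathOfLength_zero_self a fun r => r.weight p]
      simp
    · have := isEmpty_pathOfLength_zero hab
      simp [hab]
  | succ k ih =>
    rw [pow_succ, Matrix.mul_apply, sum_pathOfLength_succ a b k fun r => r.weight p]
    simp_rw [ih, edgeMatrix, Finset.sum_mul_sum, Quiver.Path.weight_cons]

/-- The transition matrix of the connection: its `(v, w)` block is `∑ p_e U_e` over the edges `e`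
from `v` to `w`. -/
noncomputable def blockMatrix {n : V → ℕ}
    (U : ∀ {a b : V}, (a ⟶ b) → Matrix (Fin (n a)) (Fin (n b)) ℂ)
    (p : ∀ {a b : V}, (a ⟶ b) → ℝ) : Matrix (Σ v, Fin (n v)) (Σ v, Fin (n v)) ℂ :=
  fun s t => ∑ e : s.1 ⟶ t.1, (p e : ℂ) * U e s.2 t.2

variable {n : V → ℕ} (U : ∀ {a b : V}, (a ⟶ b) → Matrix (Fin (n a)) (Fin (n b)) ℂ)
  (p : ∀ {a b : V}, (a ⟶ b) → ℝ)

theorem blockMatrix_pow_apply [DecidableEq V] (k : ℕ) (s t : Σ v, Fin (n v)) :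
    (blockMatrix U p ^ k) s t =
      ∑ r : PathOfLength s.1 t.1 k, ((r.1.weight p : ℝ) : ℂ) * hol U r.1 s.2 t.2 := by
  induction k generalizing t with
  | zero =>
    obtain ⟨a, i⟩ := s
    obtain ⟨b, j⟩ := t
    rw [pow_zero]
    by_cases hab : a = b
    · subst hab
      rw [sum_pathOfLength_zero_self a fun r => ((r.weight p : ℝ) : ℂ) * hol U r i j]
      simp [hol, Matrix.one_apply, Sigma.mk.injEq]
    · have := isEmpty_pathOfLength_zero hab
      simp [hab]
  | succ k ih =>
    rw [pow_succ, Matrix.mul_apply, Fintype.sum_sigma,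
      sum_pathOfLength_succ s.1 t.1 k fun r => ((r.weight p : ℝ) : ℂ) * hol U r s.2 t.2]
    refine Finset.sum_congr rfl fun c _ => ?_
    have h1 : ∀ x, (blockMatrix U p ^ k) s ⟨c, x⟩ =
        ∑ r : PathOfLength s.1 c k, ((r.1.weight p : ℝ) : ℂ) * hol U r.1 s.2 x :=
      fun x => ih ⟨c, x⟩
    have h2 : ∀ x, blockMatrix U p ⟨c, x⟩ t = ∑ e : c ⟶ t.1, (p e : ℂ) * U e x t.2 :=
      fun x => rfl
    simp_rw [h1, h2, Finset.sum_mul_sum, Quiver.Path.weight_cons, hol, Matrix.mul_apply,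
      Finset.mul_sum]
    refine Eq.trans Finset.sum_comm ?_
    refine Finset.sum_congr rfl fun r _ => ?_
    refine Eq.trans Finset.sum_comm ?_
    refine Finset.sum_congr rfl fun e _ => Finset.sum_congr rfl fun j _ => ?_
    push_cast
    ring

theorem trace_blockMatrix_pow [DecidableEq V] (k : ℕ) :
    (blockMatrix U p ^ k).trace =
      ∑ a : V, ∑ r : PathOfLength a a k, ((r.1.weight p : ℝ) : ℂ) * (hol U r.1).trace := by
  rw [Matrix.trace, Fintype.sum_sigma]
  refine Finset.sum_congr rfl fun a _ => ?_
  simp only [Matrix.diag_apply, blockMatrix_pow_apply, Matrix.trace, Finset.mul_sum]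
  rw [Finset.sum_comm]

end PathSums

/-! ### Decay of strictly substochastic matrices. -/

section RowSums

variable {V : Type*} [Fintype V] [DecidableEq V] (P : Matrix V V ℝ)

/-- The sum of the `a`-th row of `P ^ k`. -/
def rowSum (k : ℕ) (a : V) : ℝ := ∑ b : V, (P ^ k) a b

theorem rowSum_add (k m : ℕ) (a : V) :
    rowSum P (k + m) a = ∑ c : V, (P ^ k) a c * rowSum P m c := by
  simp only [rowSum, pow_add, Matrix.mul_apply, Finset.mul_sum]
  rw [Finset.sum_comm]

theorem rowSum_zero (a : V) : rowSum P 0 a = 1 := by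
  simp [rowSum, Matrix.one_apply]

variable {P}

theorem pow_apply_nonneg (hP : ∀ a b, 0 ≤ P a b) (k : ℕ) (a b : V) : 0 ≤ (P ^ k) a b := by
  induction k generalizing b with
  | zero =>
    rw [pow_zero, Matrix.one_apply]
    split_ifs <;> norm_num
  | succ k ih =>
    rw [pow_succ, Matrix.mul_apply]
    exact Finset.sum_nonneg fun c _ => mul_nonneg (ih c) (hP c b)

theorem rowSum_nonneg (hP : ∀ a b, 0 ≤ P a b) (k : ℕ) (a : V) : 0 ≤ rowSum P k a :=
  Finset.sum_nonneg fun b _ => pow_apply_nonneg hP k a b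

theorem rowSum_add_le (hP : ∀ a b, 0 ≤ P a b) {m : ℕ} {r : ℝ} (hr : ∀ c, rowSum P m c ≤ r)
    (k : ℕ) (a : V) : rowSum P (k + m) a ≤ r * rowSum P k a := by
  rw [rowSum_add, rowSum, mul_comm, Finset.sum_mul]
  exact Finset.sum_le_sum fun c _ =>
    mul_le_mul_of_nonneg_left (hr c) (pow_apply_nonneg hP k a c)

theorem rowSum_antitone (hP : ∀ a b, 0 ≤ P a b) (h1 : ∀ a, rowSum P 1 a ≤ 1) (a : V) :
    Antitone fun k => rowSum P k a :=
  antitone_nat_of_succ_le fun k => by simpa using rowSum_add_le hP h1 k a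

/-- Loss of mass propagates backwards: if mass starting at `c` is partly lost within `k` steps and
`a` sends positive mass to `c`, then `a` loses mass within `1 + k` steps. -/
theorem exists_rowSum_lt_one (hP : ∀ a b, 0 ≤ P a b) (h1 : ∀ a, rowSum P 1 a ≤ 1) {a b : V}
    (hb : rowSum P 1 b < 1) (hab : Relation.ReflTransGen (fun v w => 0 < P v w) a b) :
    ∃ k, rowSum P k a < 1 := by
  induction hab using Relation.ReflTransGen.head_induction_on with
  | refl => exact ⟨1, hb⟩
  | @head a c hac _ ih =>
    obtain ⟨k, hk⟩ := ih
    refine ⟨1 + k, lt_of_lt_of_le ?_ (h1 a)⟩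
    rw [rowSum_add, rowSum, pow_one]
    have hle : ∀ d, rowSum P k d ≤ 1 := fun d =>
      (rowSum_antitone hP h1 d (Nat.zero_le k)).trans_eq (rowSum_zero P d)
    exact Finset.sum_lt_sum (fun d _ => mul_le_of_le_one_right (hP a d) (hle d))
      ⟨c, Finset.mem_univ c, mul_lt_of_lt_one_right hac hk⟩

/-- The powers of a strictly substochastic matrix are summable. -/
theorem summable_rowSum (hP : ∀ a b, 0 ≤ P a b) (h1 : ∀ a, rowSum P 1 a ≤ 1)
    (hlt : ∀ a, ∃ k, rowSum P k a < 1) (a : V) : Summable fun k => rowSum P k a := by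
  choose K hK using hlt
  set m := Finset.univ.sup K with hm
  have hm1 : ∀ c, rowSum P m c < 1 := fun c =>
    (rowSum_antitone hP h1 c (Finset.le_sup (Finset.mem_univ c))).trans_lt (hK c)
  have : Nonempty V := ⟨a⟩
  obtain ⟨c₀, hc₀⟩ := Finite.exists_max fun c => rowSum P m c
  set r := rowSum P m c₀
  have hr1 : r < 1 := hm1 c₀
  have hr0 : 0 ≤ r := rowSum_nonneg hP m c₀
  -- With `S n` the `n`-th partial sum, `S n ≤ S (m + n) ≤ m + r * S n`, whence `S n ≤ m / (1 - r)`.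
  refine summable_of_sum_range_le (c := m / (1 - r)) (fun k => rowSum_nonneg hP k a) fun n => ?_
  have hmono : ∑ k ∈ Finset.range n, rowSum P k a ≤
      ∑ k ∈ Finset.range (m + n), rowSum P k a :=
    Finset.sum_le_sum_of_subset_of_nonneg (Finset.range_mono (Nat.le_add_left n m))
      fun k _ _ => rowSum_nonneg hP k a
  have hhead : ∑ k ∈ Finset.range m, rowSum P k a ≤ m := by
    refine (Finset.sum_le_card_nsmul _ _ 1 fun k _ => ?_).trans_eq (by simp)
    exact (rowSum_antitone hP h1 a (Nat.zero_le k)).trans_eq (rowSum_zero P a)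
  have htail : ∑ k ∈ Finset.range n, rowSum P (m + k) a ≤
      r * ∑ k ∈ Finset.range n, rowSum P k a := by
    rw [Finset.mul_sum]
    refine Finset.sum_le_sum fun k _ => ?_
    rw [add_comm]
    exact rowSum_add_le hP hc₀ k a
  rw [Finset.sum_range_add] at hmono
  rw [le_div_iff₀ (by linarith)]
  linarith

end RowSums

/-! ### Uniform bounds on holonomies. -/

section Bounds

/-- Every linear functional on a finite-dimensional space is bounded for any seminorm which
separates points. -/
theorem exists_norm_apply_le {E : Type*} [AddCommGroup E] [Module ℂ E] [FiniteDimensional ℂ E]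
    (N : Seminorm ℂ E) (hN : ∀ f, N f = 0 → f = 0) (L : E →ₗ[ℂ] ℂ) :
    ∃ C : ℝ, ∀ f, ‖L f‖ ≤ C * N f := by
  let _ : Norm E := ⟨N⟩
  have core : NormedSpace.Core ℂ E :=
    { norm_nonneg := fun f => apply_nonneg N f
      norm_smul := fun c f => map_smul_eq_mul N c f
      norm_triangle := fun f g => map_add_le_add N f g
      norm_eq_zero_iff := fun f => ⟨hN f, fun h => h ▸ map_zero N⟩ }
  let _ : NormedAddCommGroup E := NormedAddCommGroup.ofCore core
  let _ : NormedSpace ℂ E := NormedSpace.ofCore core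
  exact ⟨‖L.toContinuousLinearMap‖, fun f => L.toContinuousLinearMap.le_opNorm f⟩

variable {V : Type*} [Quiver V] {n : V → ℕ}
  {U : ∀ {a b : V}, (a ⟶ b) → Matrix (Fin (n a)) (Fin (n b)) ℂ}
  {N : ∀ v : V, Seminorm ℂ (Fin (n v) → ℂ)}

theorem seminorm_hol_mulVec_le
    (hU : ∀ {a b : V} (e : a ⟶ b) (f : Fin (n b) → ℂ), N a ((U e).mulVec f) ≤ N b f)
    {a b : V} (p : Quiver.Path a b) (f : Fin (n b) → ℂ) :
    N a ((hol U p).mulVec f) ≤ N b f := by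
  induction p with
  | nil => simp [hol]
  | cons p e ih =>
    rw [hol, ← Matrix.mulVec_mulVec]
    exact (ih _).trans (hU e f)

/-- An entry of `hol U p` is a coordinate of the image of a basis vector. Holonomies are
contractions and coordinates are bounded for `N`, so the bound depends only on the two indices, of
which there are finitely many pairs. -/
theorem exists_norm_hol_le [Finite V] (hN : ∀ (v : V) (f : Fin (n v) → ℂ), N v f = 0 → f = 0)
    (hU : ∀ {a b : V} (e : a ⟶ b) (f : Fin (n b) → ℂ), N a ((U e).mulVec f) ≤ N b f) :
    ∃ C : ℝ, ∀ {a b : V} (p : Quiver.Path a b) (i : Fin (n a)) (j : Fin (n b)),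
      ‖hol U p i j‖ ≤ C := by
  classical
  choose C hC using fun s : Σ v, Fin (n v) =>
    exists_norm_apply_le (N s.1) (hN s.1) (LinearMap.proj s.2)
  have hle : ∀ {a b : V} (p : Quiver.Path a b) (i : Fin (n a)) (j : Fin (n b)),
      ‖hol U p i j‖ ≤ |C ⟨a, i⟩| * N b (Pi.single j 1) := by
    intro a b p i j
    have h1 := hC ⟨a, i⟩ ((hol U p).mulVec (Pi.single j 1))
    simp only [LinearMap.proj_apply, Matrix.mulVec_single_one, Matrix.col_apply] at h1
    refine h1.trans ?_
    rw [← Matrix.mulVec_single_one]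
    exact mul_le_mul (le_abs_self _) (seminorm_hol_mulVec_le hU p _) (apply_nonneg _ _)
      (abs_nonneg _)
  obtain ⟨B, hB⟩ := (Set.finite_range fun q : (Σ v, Fin (n v)) × (Σ v, Fin (n v)) =>
    |C q.1| * N q.2.1 (Pi.single q.2.2 1)).bddAbove
  exact ⟨B, fun p i j => (hle p i j).trans (hB ⟨(⟨_, i⟩, ⟨_, j⟩), rfl⟩)⟩

end Bounds

/-! ### The Euler product for `det (1 - T)`. -/

section EulerProduct

open Filter Topology

/-- Makes the traces independent of the base point. The exponent must be positive: at exponent `0`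
the traces are the sizes of two index types. -/
theorem trace_mul_pow_comm {ι ι' R : Type*} [Fintype ι] [Fintype ι'] [DecidableEq ι]
    [DecidableEq ι'] [CommRing R] (A : Matrix ι ι' R) (B : Matrix ι' ι R) (k : ℕ) :
    ((A * B) ^ (k + 1)).trace = ((B * A) ^ (k + 1)).trace := by
  have h : ∀ k : ℕ, (A * B) ^ k * A = A * (B * A) ^ k := by
    intro k
    induction k with
    | zero => simp
    | succ k ih =>
      rw [pow_succ', Matrix.mul_assoc, ih, pow_succ' (B * A)]
      simp only [Matrix.mul_assoc]
  rw [pow_succ, ← Matrix.mul_assoc, h, Matrix.mul_assoc, Matrix.trace_mul_comm, Matrix.mul_assoc,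
    ← pow_succ]

variable {V : Type*} [Quiver V] {n : V → ℕ}
  (U : ∀ {a b : V}, (a ⟶ b) → Matrix (Fin (n a)) (Fin (n b)) ℂ)
  (p : ∀ {a b : V}, (a ⟶ b) → ℝ)

namespace ClosedWalk

/-- The holonomy of a closed walk times its weight. -/
noncomputable def holMatrix (w : ClosedWalk V) : Matrix (Fin (n w.base)) (Fin (n w.base)) ℂ :=
  ((w.path.weight p : ℝ) : ℂ) • hol U w.path

theorem weight_powPath {a : V} (r : Quiver.Path a a) (k : ℕ) :
    (powPath r k).weight p = r.weight p ^ k := by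
  induction k with
  | zero => simp [powPath]
  | succ k ih => rw [powPath, Quiver.Path.weight_comp, ih, pow_succ']

theorem hol_powPath {a : V} (r : Quiver.Path a a) (k : ℕ) :
    hol U (powPath r k) = hol U r ^ k := by
  induction k with
  | zero => simp [powPath, hol]
  | succ k ih => rw [powPath, hol_comp, ih, pow_succ']

theorem length_powPath {a : V} (r : Quiver.Path a a) (k : ℕ) :
    (powPath r k).length = k * r.length := by
  rw [← length_edges, edges_powPath, length_listPow, length_edges]

theorem holMatrix_pow (w : ClosedWalk V) (k : ℕ) :
    (w.pow k).holMatrix U p = w.holMatrix U p ^ (k + 1) := by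
  change (((powPath w.path (k + 1)).weight p : ℝ) : ℂ) • hol U (ClosedWalk.powPath w.path (k + 1)) = _
  rw [weight_powPath, hol_powPath, holMatrix, smul_pow]
  push_cast
  rfl

theorem length_pow (w : ClosedWalk V) (k : ℕ) :
    (w.pow k).path.length = (k + 1) * w.path.length :=
  length_powPath _ _

theorem pow_injective (w : ClosedWalk V) : Function.Injective w.pow := by
  intro k k' h
  have hl : (w.pow k).path.length = (w.pow k').path.length := by rw [h]
  rw [length_pow, length_pow] at hl
  simpa using Nat.eq_of_mul_eq_mul_right w.pos hl

theorem trace_holMatrix_pow_eq {w w' : ClosedWalk V}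
    (h : (Quot.mk _ w : QCycle V) = Quot.mk _ w') (k : ℕ) :
    (w.holMatrix U p ^ (k + 1)).trace = (w'.holMatrix U p ^ (k + 1)).trace := by
  have key : ∀ v v' : ClosedWalk V, Rotates v v' →
      (v.holMatrix U p ^ (k + 1)).trace = (v'.holMatrix U p ^ (k + 1)).trace := by
    rintro _ _ ⟨r, s, _, _⟩
    simp only [holMatrix, hol_comp, Quiver.Path.weight_comp, smul_pow, Matrix.trace_smul]
    rw [trace_mul_pow_comm, mul_comm (r.weight p)]
  exact congrArg (Quot.lift _ key) h

/-- The contribution of a closed walk to `- log det (1 - T)`. -/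
noncomputable def logTerm (w : ClosedWalk V) : ℂ :=
  (w.holMatrix U p).trace / (w.path.length : ℂ)

variable (V) in
/-- A closed walk is a closed path together with its length. -/
def equivSigma : (Σ (k : ℕ) (a : V), PathOfLength a a (k + 1)) ≃ ClosedWalk V where
  toFun s := ⟨s.2.1, s.2.2.1, s.2.2.2.symm ▸ Nat.succ_pos s.1⟩
  invFun w := ⟨w.path.length - 1, w.base, w.path, (Nat.succ_pred_eq_of_pos w.pos).symm⟩
  left_inv := by
    rintro ⟨k, a, r, hr⟩
    obtain rfl : k = r.length - 1 := by omega
    rfl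
  right_inv _ := rfl

end ClosedWalk

theorem eulerFactor_mk (w : ClosedWalk V) :
    eulerFactor U p (Quot.mk _ w) = (1 - w.holMatrix U p).det := rfl

variable [Fintype V] [DecidableEq V] [∀ a b : V, Fintype (a ⟶ b)] {U p}

/-- The closed walks of length `k + 1` based at `a` have total weight equal to a diagonal entry of
the `(k + 1)`-st power, at most its row sum. -/
theorem summable_weight (hp : ∀ {a b : V} (e : a ⟶ b), 0 ≤ p e)
    (hs : ∀ a, Summable fun k => rowSum (edgeMatrix p) k a) :
    Summable fun w : ClosedWalk V => w.path.weight p := by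
  rw [← (ClosedWalk.equivSigma V).summable_iff]
  have hw : ∀ {a b : V} (r : Quiver.Path a b), 0 ≤ r.weight p :=
    fun r => Quiver.Path.weight_nonneg (fun e => hp e) r
  refine (summable_sigma_of_nonneg fun s => hw _).2 ⟨fun k => (hasSum_fintype _).summable, ?_⟩
  have h1 : Summable fun k => ∑ a, rowSum (edgeMatrix p) (k + 1) a :=
    summable_sum fun a _ => (summable_nat_add_iff 1).2 (hs a)
  refine h1.of_nonneg_of_le (fun k => tsum_nonneg fun s => hw _) fun k => ?_
  rw [tsum_fintype, Fintype.sum_sigma]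
  refine Finset.sum_le_sum fun a _ => ?_
  have h2 : ∑ r : PathOfLength a a (k + 1), r.1.weight p = (edgeMatrix p ^ (k + 1)) a a :=
    (edgeMatrix_pow_apply p (k + 1) a a).symm
  refine h2.trans_le ?_
  exact Finset.single_le_sum (f := fun b => (edgeMatrix p ^ (k + 1)) a b)
    (fun b _ => pow_apply_nonneg (fun a b => Finset.sum_nonneg fun e _ => hp e) _ a b)
    (Finset.mem_univ a)

variable {C : ℝ}

theorem summable_norm_logTerm (hp : ∀ {a b : V} (e : a ⟶ b), 0 ≤ p e)
    (hs : ∀ a, Summable fun k => rowSum (edgeMatrix p) k a)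
    (hC : ∀ {a b : V} (r : Quiver.Path a b) (i : Fin (n a)) (j : Fin (n b)),
      ‖hol U r i j‖ ≤ C) :
    Summable fun w : ClosedWalk V => ‖w.logTerm U p‖ := by
  have hw : ∀ {a b : V} (r : Quiver.Path a b), 0 ≤ r.weight p :=
    fun r => Quiver.Path.weight_nonneg (fun e => hp e) r
  refine ((summable_weight hp hs).mul_left ((∑ v, n v : ℕ) * |C|)).of_nonneg_of_le
    (fun w => norm_nonneg _) fun w => ?_
  have h1 : ‖(hol U w.path).trace‖ ≤ (∑ v, n v : ℕ) * |C| := by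
    refine (norm_sum_le _ _).trans ?_
    refine (Finset.sum_le_card_nsmul _ _ |C| fun i _ =>
      (hC w.path i i).trans (le_abs_self C)).trans ?_
    rw [Finset.card_univ, Fintype.card_fin, nsmul_eq_mul]
    refine mul_le_mul_of_nonneg_right (Nat.cast_le.2 ?_) (abs_nonneg C)
    exact Finset.single_le_sum (f := n) (fun _ _ => Nat.zero_le _) (Finset.mem_univ w.base)
  have h2 : (1 : ℝ) ≤ w.path.length := Nat.one_le_cast.2 w.pos
  rw [ClosedWalk.logTerm, ClosedWalk.holMatrix, Matrix.trace_smul, norm_div, norm_smul,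
    Complex.norm_natCast, Complex.norm_real, Real.norm_of_nonneg (hw _), mul_comm]
  exact (div_le_self (mul_nonneg (norm_nonneg _) (hw _)) h2).trans
    (mul_le_mul_of_nonneg_right h1 (hw _))

/-- The powers of `w` are distinct closed walks, so their weights form a subfamily of a summable
family and tend to zero. -/
theorem tendsto_holMatrix_pow (hp : ∀ {a b : V} (e : a ⟶ b), 0 ≤ p e)
    (hs : ∀ a, Summable fun k => rowSum (edgeMatrix p) k a)
    (hC : ∀ {a b : V} (r : Quiver.Path a b) (i : Fin (n a)) (j : Fin (n b)),
      ‖hol U r i j‖ ≤ C) (w : ClosedWalk V) (i j : Fin (n w.base)) :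
    Tendsto (fun k => (w.holMatrix U p ^ k) i j) atTop (𝓝 0) := by
  have hw : ∀ {a b : V} (r : Quiver.Path a b), 0 ≤ r.weight p :=
    fun r => Quiver.Path.weight_nonneg (fun e => hp e) r
  have h1 := ((summable_weight hp hs).comp_injective w.pow_injective).tendsto_atTop_zero.mul_const C
  rw [zero_mul] at h1
  rw [← tendsto_add_atTop_iff_nat 1]
  refine squeeze_zero_norm (fun k => ?_) h1
  rw [← ClosedWalk.holMatrix_pow]
  change ‖(((w.pow k).path.weight p : ℝ) : ℂ) * hol U (ClosedWalk.powPath w.path (k + 1)) i j‖ ≤ _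
  rw [norm_mul, Complex.norm_real, Real.norm_of_nonneg (hw _)]
  exact mul_le_mul_of_nonneg_left (hC _ _ _) (hw _)

theorem tendsto_blockMatrix_pow (hp : ∀ {a b : V} (e : a ⟶ b), 0 ≤ p e)
    (hs : ∀ a, Summable fun k => rowSum (edgeMatrix p) k a)
    (hC : ∀ {a b : V} (r : Quiver.Path a b) (i : Fin (n a)) (j : Fin (n b)),
      ‖hol U r i j‖ ≤ C) (s t : Σ v, Fin (n v)) :
    Tendsto (fun k => (blockMatrix U p ^ k) s t) atTop (𝓝 0) := by
  have hw : ∀ {a b : V} (r : Quiver.Path a b), 0 ≤ r.weight p :=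
    fun r => Quiver.Path.weight_nonneg (fun e => hp e) r
  have h1 := (hs s.1).tendsto_atTop_zero.mul_const |C|
  rw [zero_mul] at h1
  refine squeeze_zero_norm (fun k => ?_) h1
  rw [blockMatrix_pow_apply]
  have h2 : (edgeMatrix p ^ k) s.1 t.1 ≤ rowSum (edgeMatrix p) k s.1 :=
    Finset.single_le_sum (f := fun b => (edgeMatrix p ^ k) s.1 b)
      (fun b _ => pow_apply_nonneg (fun a b => Finset.sum_nonneg fun e _ => hp e) _ _ b)
      (Finset.mem_univ t.1)
  refine le_trans ?_ (mul_le_mul_of_nonneg_right h2 (abs_nonneg C))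
  rw [edgeMatrix_pow_apply, Finset.sum_mul]
  refine norm_sum_le_of_le _ fun r _ => ?_
  rw [norm_mul, Complex.norm_real, Real.norm_of_nonneg (hw _)]
  exact mul_le_mul_of_nonneg_left ((hC _ _ _).trans (le_abs_self C)) (hw _)

/-- `- log det (1 - T)` is the sum of the contributions of all closed walks. -/
theorem exists_hasSum_logTerm (hp : ∀ {a b : V} (e : a ⟶ b), 0 ≤ p e)
    (hs : ∀ a, Summable fun k => rowSum (edgeMatrix p) k a)
    (hC : ∀ {a b : V} (r : Quiver.Path a b) (i : Fin (n a)) (j : Fin (n b)),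
      ‖hol U r i j‖ ≤ C) :
    ∃ s : ℂ, HasSum (fun w : ClosedWalk V => w.logTerm U p) s ∧
      Complex.exp (-s) = (1 - blockMatrix U p).det := by
  obtain ⟨s, hs1, hs2⟩ := exists_hasSum_trace_pow _ (tendsto_blockMatrix_pow hp hs hC)
  refine ⟨s, ?_, hs2⟩
  obtain ⟨t, h1⟩ : ∃ t, HasSum (fun w : ClosedWalk V => w.logTerm U p) t :=
    (summable_norm_logTerm hp hs hC).of_norm
  have h2 := ((ClosedWalk.equivSigma V).hasSum_iff.2 h1).sigma fun k => hasSum_fintype _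
  -- `s` sums the traces length by length; grouping the absolutely convergent sum over walks by
  -- length gives the same series.
  suffices s = t by rwa [this]
  refine hs1.unique ?_
  convert h2 using 2 with k
  rw [trace_blockMatrix_pow, Fintype.sum_sigma, Finset.sum_div]
  refine Finset.sum_congr rfl fun a _ => ?_
  rw [Finset.sum_div]
  refine Finset.sum_congr rfl fun r _ => ?_
  obtain ⟨r, hr⟩ := r
  simp [ClosedWalk.logTerm, ClosedWalk.holMatrix, ClosedWalk.equivSigma, hr]

/-- `- log` of the Euler factor of a prime cycle is the sum of the contributions of the closed
walks which are powers of it. -/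
theorem exists_hasSum_logTerm_primeCycle (hp : ∀ {a b : V} (e : a ⟶ b), 0 ≤ p e)
    (hs : ∀ a, Summable fun k => rowSum (edgeMatrix p) k a)
    (hC : ∀ {a b : V} (r : Quiver.Path a b) (i : Fin (n a)) (j : Fin (n b)),
      ‖hol U r i j‖ ≤ C) (c : PrimeCycle V) :
    ∃ s : ℂ, HasSum (fun y : ℕ × Fin c.rep.path.length =>
        ((c.rotRep y.2).pow y.1).logTerm U p) s ∧
      Complex.exp (-s) = eulerFactor U p c.1 := by
  obtain ⟨s, hs1, hs2⟩ := exists_hasSum_trace_pow _ (tendsto_holMatrix_pow hp hs hC c.rep)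
  refine ⟨s, ?_, ?_⟩
  · obtain ⟨t, h1⟩ : ∃ t, HasSum (fun y : ℕ × Fin c.rep.path.length =>
        ((c.rotRep y.2).pow y.1).logTerm U p) t :=
      (summable_norm_logTerm hp hs hC).of_norm.comp_injective
        ((bijective_pow_rotRep V).injective.comp (sigma_mk_injective (i := c)))
    have h2 := h1.prod_fiberwise fun k => hasSum_fintype _
    suffices s = t by rwa [this]
    refine hs1.unique ?_
    convert h2 using 2 with k
    -- All base points contribute equally, and the power has length `(k + 1) ℓ`; summing over the
    -- `ℓ` base points cancels the factor `ℓ`.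
    have h3 : ∀ i : Fin c.rep.path.length, ((c.rotRep i).pow k).logTerm U p =
        (c.rep.holMatrix U p ^ (k + 1)).trace / (k + 1) / c.rep.path.length := by
      intro i
      have h4 : (((c.rotRep i).pow k).holMatrix U p).trace =
          ((c.rotRep i).holMatrix U p ^ (k + 1)).trace :=
        congrArg Matrix.trace ((c.rotRep i).holMatrix_pow U p k)
      rw [ClosedWalk.logTerm, h4, ClosedWalk.length_pow, c.length_rotRep,
        ClosedWalk.trace_holMatrix_pow_eq U p ((c.mk_rotRep i).trans c.mk_rep.symm), div_div]
      push_cast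
      rfl
    have hne : (c.rep.path.length : ℂ) ≠ 0 := Nat.cast_ne_zero.2 c.rep.pos.ne'
    simp only [h3, Finset.sum_const, Finset.card_univ, Fintype.card_fin,
      nsmul_eq_mul]
    rw [mul_div_cancel₀ _ hne]
  · rw [hs2, ← eulerFactor_mk, c.mk_rep]

/-- The Euler product for `det (1 - T)`, where `T` is a twisted transition matrix with summable
powers and bounded holonomies. -/
theorem summable_and_hasProd_eulerFactor (hp : ∀ {a b : V} (e : a ⟶ b), 0 ≤ p e)
    (hs : ∀ a, Summable fun k => rowSum (edgeMatrix p) k a)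
    (hC : ∀ {a b : V} (r : Quiver.Path a b) (i : Fin (n a)) (j : Fin (n b)),
      ‖hol U r i j‖ ≤ C) :
    Summable (fun c : PrimeCycle V => ‖eulerFactor U p c.1 - 1‖) ∧
    HasProd (fun c : PrimeCycle V => eulerFactor U p c.1) (1 - blockMatrix U p).det := by
  obtain ⟨s, hs1, hs2⟩ := exists_hasSum_logTerm (U := U) (p := p) hp hs hC
  choose ℓ hℓ1 hℓ2 using exists_hasSum_logTerm_primeCycle (U := U) (p := p) hp hs hC
  let e := Equiv.ofBijective _ (bijective_pow_rotRep V)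
  have hnorm := e.summable_iff.2 (summable_norm_logTerm (U := U) (p := p) hp hs hC)
  constructor
  · have h1 : Summable fun c => ‖ℓ c‖ := by
      refine hnorm.sigma.of_nonneg_of_le (fun c => norm_nonneg _) fun c => ?_
      rw [← (hℓ1 c).tsum_eq]
      exact norm_tsum_le_tsum_norm (hnorm.sigma_factor c)
    -- The estimate `‖exp z - 1‖ ≤ 2 ‖z‖` is used for `‖z‖ ≤ 1`, which fails for at most finitely
    -- many prime cycles.
    have h2 : ∀ᶠ c in cofinite, ‖ℓ c‖ < 1 := h1.tendsto_cofinite_zero.eventually_lt_const one_pos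
    refine Summable.of_norm_bounded_eventually (h1.mul_left 2) ?_
    filter_upwards [h2] with c hc
    rw [norm_norm, ← hℓ2, ← norm_neg (ℓ c)]
    exact Complex.norm_exp_sub_one_le (by rw [norm_neg]; exact hc.le)
  · have h1 : HasSum ℓ s := (e.hasSum_iff.2 hs1).sigma hℓ1
    have h2 := h1.neg.cexp
    rw [hs2] at h2
    convert h2 using 1
    funext c
    exact (hℓ2 c).symm

end EulerProduct

/-! ### From the Laplacian to the transition matrix. -/

section Laplacian

variable {V : Type*} [Quiver V] [Fintype V] [∀ a b : V, Fintype (a ⟶ b)]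
  {x : ∀ {a b : V}, (a ⟶ b) → ℝ} {κ : V → ℝ}

/-- The path from `a` is either empty, so `κ a > 0`, or starts with an edge of positive weight, so
`z_a > 0`. -/
theorem outWeight_add_pos (hx : ∀ {a b : V} (e : a ⟶ b), 0 ≤ x e) (hκ : ∀ a, 0 ≤ κ a)
    (hκ' : ∀ a : V, ∃ b : V, 0 < κ b ∧
      Relation.ReflTransGen (fun v w : V => ∃ e : v ⟶ w, 0 < x e) a b) (a : V) :
    0 < outWeight x a + κ a := by
  have hz : 0 ≤ outWeight x a :=
    Finset.sum_nonneg fun b _ => Finset.sum_nonneg fun e _ => hx e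
  obtain ⟨b, hb, hab⟩ := hκ' a
  rcases hab.cases_head with rfl | ⟨c, ⟨e, he⟩, _⟩
  · exact add_pos_of_nonneg_of_pos hz hb
  · refine add_pos_of_pos_of_nonneg ?_ (hκ a)
    exact Finset.sum_pos' (fun b _ => Finset.sum_nonneg fun e _ => hx e)
      ⟨c, Finset.mem_univ c, Finset.sum_pos' (fun e _ => hx e) ⟨e, Finset.mem_univ e, he⟩⟩

theorem transWeight_nonneg (hx : ∀ {a b : V} (e : a ⟶ b), 0 ≤ x e)
    (hpos : ∀ a, 0 < outWeight x a + κ a) {a b : V} (e : a ⟶ b) : 0 ≤ transWeight x κ e :=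
  div_nonneg (hx e) (hpos a).le

variable [DecidableEq V]

theorem rowSum_one_transWeight (a : V) :
    rowSum (edgeMatrix (transWeight x κ)) 1 a = outWeight x a / (outWeight x a + κ a) := by
  simp only [rowSum, pow_one, edgeMatrix, transWeight, outWeight, Finset.sum_div]

theorem summable_rowSum_transWeight (hx : ∀ {a b : V} (e : a ⟶ b), 0 ≤ x e) (hκ : ∀ a, 0 ≤ κ a)
    (hκ' : ∀ a : V, ∃ b : V, 0 < κ b ∧
      Relation.ReflTransGen (fun v w : V => ∃ e : v ⟶ w, 0 < x e) a b) (a : V) :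
    Summable fun k => rowSum (edgeMatrix (transWeight x κ)) k a := by
  have hpos := outWeight_add_pos hx hκ hκ'
  have hP : ∀ a b, 0 ≤ edgeMatrix (transWeight x κ) a b := fun a b =>
    Finset.sum_nonneg fun e _ => transWeight_nonneg hx hpos e
  have h1 : ∀ a, rowSum (edgeMatrix (transWeight x κ)) 1 a ≤ 1 := fun a => by
    rw [rowSum_one_transWeight, div_le_one (hpos a)]
    linarith [hκ a]
  refine summable_rowSum hP h1 (fun a => ?_) a
  obtain ⟨b, hb, hab⟩ := hκ' a
  refine exists_rowSum_lt_one hP h1 (b := b) ?_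
    (Relation.ReflTransGen.mono ?_ _ _ hab)
  · rw [rowSum_one_transWeight, div_lt_one (hpos b)]
    linarith
  · rintro v w ⟨e, he⟩
    exact Finset.sum_pos' (fun e _ => transWeight_nonneg hx hpos e)
      ⟨e, Finset.mem_univ e, div_pos he (hpos v)⟩

theorem det_diagOp_add_laplacian {n : V → ℕ}
    (U : ∀ {a b : V}, (a ⟶ b) → Matrix (Fin (n a)) (Fin (n b)) ℂ)
    (hpos : ∀ a, 0 < outWeight x a + κ a) :
    LinearMap.det (diagOp n κ + laplacian x U) =
      (∏ v : V, ((outWeight x v + κ v : ℝ) : ℂ) ^ n v) *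
        (1 - blockMatrix U (transWeight x κ)).det := by
  let b := Pi.basis fun v : V => Pi.basisFun ℂ (Fin (n v))
  have hmat : LinearMap.toMatrix b b (diagOp n κ + laplacian x U) =
      Matrix.diagonal (fun s : Σ v, Fin (n v) => ((outWeight x s.1 + κ s.1 : ℝ) : ℂ)) *
        (1 - blockMatrix U (transWeight x κ)) := by
    ext ⟨v, i⟩ ⟨w, j⟩
    have hne : ((outWeight x v + κ v : ℝ) : ℂ) ≠ 0 := Complex.ofReal_ne_zero.2 (hpos v).ne'
    have hentry : ∀ f : ∀ v : V, Fin (n v) → ℂ, (diagOp n κ + laplacian x U) f v i =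
        ((outWeight x v + κ v : ℝ) : ℂ) * f v i -
          ∑ w : V, ∑ e : v ⟶ w, ((x e : ℝ) : ℂ) * (U e).mulVec (f w) i := by
      intro f
      simp only [LinearMap.add_apply, Pi.add_apply, diagOp, laplacian, LinearMap.coe_mk,
        AddHom.coe_mk, Finset.sum_apply, Pi.smul_apply, Pi.sub_apply, smul_eq_mul, mul_sub,
        Finset.sum_sub_distrib, ← Finset.sum_mul, outWeight]
      push_cast
      ring
    have hb : b ⟨w, j⟩ = Pi.single w (Pi.single j 1) := by
      simp [b, Pi.basis_apply]
    have hrepr : ∀ f, b.repr f ⟨v, i⟩ = f v i := fun f => by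
      simp [b, Pi.basis_repr]
    rw [LinearMap.toMatrix_apply, hrepr, hentry, hb, Matrix.diagonal_mul, Matrix.sub_apply, mul_sub]
    congr 1
    · congr 1
      by_cases hvw : v = w
      · subst hvw
        simp [Matrix.one_apply, Pi.single_apply]
      · simp [hvw]
    · rw [Finset.sum_eq_single w (fun u _ hu => by simp [hu]) (by simp), blockMatrix,
        Finset.mul_sum]
      refine Finset.sum_congr rfl fun e _ => ?_
      simp only [Pi.single_eq_same, Matrix.mulVec_single_one, Matrix.col_apply, transWeight]
      rw [← mul_assoc, Complex.ofReal_div, mul_div_cancel₀ _ hne]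
  rw [← LinearMap.det_toMatrix b, hmat, Matrix.det_mul, Matrix.det_diagonal, Fintype.prod_sigma]
  simp

end Laplacian

end QuiverEuler

open QuiverEuler in
/-- Here `hnorm` and `hU` say that, for suitable norms on the spaces `ℂ^{n_v}`, the operator norm
of every `U_e : ℂ^{n_{t(e)}} → ℂ^{n_{s(e)}}` is at most `1`; `hκ'` says that from every vertex one
can reach, along edges of positive weight, a vertex where `κ` is positive. -/
theorem theorem7p2 {V : Type*} [Fintype V] [Quiver V] [∀ a b : V, Fintype (a ⟶ b)]
    (loopless : ∀ a : V, IsEmpty (a ⟶ a))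
    (n : V → ℕ) (hn : ∀ v, 1 ≤ n v)
    (U : ∀ {a b : V}, (a ⟶ b) → Matrix (Fin (n a)) (Fin (n b)) ℂ)
    (x : ∀ {a b : V}, (a ⟶ b) → ℝ) (hx : ∀ {a b : V} (e : a ⟶ b), 0 ≤ x e)
    (κ : V → ℝ) (hκ : ∀ a, 0 ≤ κ a)
    (hκ' : ∀ a : V, ∃ b : V, 0 < κ b ∧
      Relation.ReflTransGen (fun v w : V => ∃ e : v ⟶ w, 0 < x e) a b)
    (N : ∀ v : V, Seminorm ℂ (Fin (n v) → ℂ))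
    (hnorm : ∀ (v : V) (f : Fin (n v) → ℂ), N v f = 0 → f = 0)
    (hU : ∀ {a b : V} (e : a ⟶ b) (f : Fin (n b) → ℂ), N a ((U e).mulVec f) ≤ N b f) :
    Summable (fun c : PrimeCycle V => ‖eulerFactor U (transWeight x κ) c.1 - 1‖) ∧
    Multipliable (fun c : PrimeCycle V => eulerFactor U (transWeight x κ) c.1) ∧
    LinearMap.det (diagOp n κ + laplacian x U) =
      (∏ v : V, ((outWeight x v + κ v : ℝ) : ℂ) ^ n v) *
        ∏' c : PrimeCycle V, eulerFactor U (transWeight x κ) c.1 := by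
  classical
  have hpos := outWeight_add_pos hx hκ hκ'
  obtain ⟨C, hC⟩ := exists_norm_hol_le hnorm hU
  obtain ⟨hsum, hprod⟩ := summable_and_hasProd_eulerFactor (transWeight_nonneg hx hpos)
    (summable_rowSum_transWeight hx hκ hκ') hC
  refine ⟨hsum, hprod.multipliable, ?_⟩
  rw [hprod.tprod_eq, det_diagOp_add_laplacian U hpos]
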